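/- Let $X$ be a continuum, i.e. a non-empty connected compact Hausdorff space, and let $$\mathrm{Sln}(X)=\sup\{|\mathcal C| : \mathcal C \text{ is a family of pairwise disjoint non-degenerate subcontinua of } X\}$$ be its Suslinian number (a subcontinuum is a subspace that is a continuum; it is non-degenerate if it has more than one point). If $\mathrm{Sln}(X)<\mathfrak c=2^{\aleph_0}$, then the covering dimension of $X$ satisfies $\dim X\le 1$, and $$\text{rim-}w(X)\;\le\;\mathrm{Sln}(X)\;\le\; hl(\exp_c(X))\;\le\; w(X)\;\le\;\mathrm{Sln}(X)^+ .$$ Here $w(Y)$ is the weight of $Y$, the smallest cardinality of a base of the topology of $Y$; $\text{rim-}w(X)$ is the minimum, over all bases $\mathcal B$ of the topology of $X$, of $\sup_{U\in\mathcal B}w(\partial U)$; $hl(Y)=\sup\{l(Z): Z\subset Y\}$ is the hereditary Lindelöf number, where $l(Z)$ is the smallest cardinal $\kappa$ such that each open cover of $Z$ has a subcover of cardinality at most $\kappa$; $\exp_c(X)$ is the space of all subcontinua of $X$ (one-point ones included), with the subspace topology from the space of non-empty closed subsets of $X$ with the Vietoris topology; and $\kappa^+$ is the successor cardinal of $\kappa$.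 -/

import Mathlib

open Set TopologicalSpace
open scoped Cardinal

universe u

namespace TopCard

/-- The weight `w(X)`: the least cardinality of a base of the topology of `X`. -/
noncomputable def weight (X : Type u) [TopologicalSpace X] : Cardinal.{u} :=
  sInf {κ | ∃ B : Set (Set X), IsTopologicalBasis B ∧ κ = #B}

/-- The Lindelöf number `l(X)`: the least cardinal `κ` such that each open cover of `X`
contains a subcover of cardinality at most `κ`. -/
noncomputable def lindelofNumber (X : Type u) [TopologicalSpace X] : Cardinal.{u} :=
  sInf {κ | ∀ 𝒰 : Set (Set X), (∀ U ∈ 𝒰, IsOpen U) → ⋃₀ 𝒰 = univ →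
    ∃ 𝒱 ⊆ 𝒰, ⋃₀ 𝒱 = univ ∧ #𝒱 ≤ κ}

/-- The hereditary Lindelöf number `hl(X)`: the supremum of the Lindelöf numbers of all
subspaces of `X`. -/
noncomputable def hereditaryLindelofNumber (X : Type u) [TopologicalSpace X] : Cardinal.{u} :=
  ⨆ Y : Set X, lindelofNumber Y

/-- The rim-weight of `X`: the least value, over all bases `B` of the topology of `X`, of the
supremum of the weights of the boundaries of the members of `B`. -/
noncomputable def rimWeight (X : Type u) [TopologicalSpace X] : Cardinal.{u} :=
  sInf {κ | ∃ B : Set (Set X), IsTopologicalBasis B ∧ κ = ⨆ U : B, weight (frontier (U : Set X))}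

/-- A disjoint family of non-degenerate subcontinua of `X`. For a Hausdorff space `X`, a subset
is a continuum in the subspace topology iff it is compact and connected (hence non-empty). -/
def IsDisjointFamilyOfSubcontinua {X : Type u} [TopologicalSpace X] (𝒞 : Set (Set X)) : Prop :=
  (∀ C ∈ 𝒞, IsCompact C ∧ IsConnected C ∧ C.Nontrivial) ∧
    ∀ C ∈ 𝒞, ∀ D ∈ 𝒞, C ≠ D → Disjoint C D

/-- The Suslinian number `Sln(X)` of a continuum `X`: the supremum of the cardinalities of
disjoint families of non-degenerate subcontinua of `X`. -/
noncomputable def suslinianNumber (X : Type u) [TopologicalSpace X] : Cardinal.{u} :=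
  ⨆ 𝒞 : {𝒞 : Set (Set X) // IsDisjointFamilyOfSubcontinua 𝒞}, #𝒞.1

/-- The hyperspace `exp_c(X)` of subcontinua of a Hausdorff space `X`, as a subspace of the
space of non-empty compact subsets of `X` with the Vietoris topology. -/
abbrev SubcontinuaHyperspace (X : Type u) [TopologicalSpace X] : Type u :=
  {K : NonemptyCompacts X // IsConnected (K : Set X)}

/-- Every finite open cover of `X` has a finite open refinement covering `X` such that each point
lies in at most `n + 1` of its members. -/
def HasCoveringDimLE (X : Type u) [TopologicalSpace X] (n : ℕ) : Prop :=
  ∀ 𝒰 : Set (Set X), 𝒰.Finite → (∀ U ∈ 𝒰, IsOpen U) → ⋃₀ 𝒰 = univ →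
    ∃ 𝒱 : Set (Set X), 𝒱.Finite ∧ (∀ V ∈ 𝒱, IsOpen V) ∧ ⋃₀ 𝒱 = univ ∧
      (∀ V ∈ 𝒱, ∃ U ∈ 𝒰, V ⊆ U) ∧ ∀ x : X, {V ∈ 𝒱 | x ∈ V}.encard ≤ n + 1

open Classical in
/-- The covering dimension `dim X` of a normal space `X`; the value `⊥` stands for the
dimension `-1` of the empty space. -/
noncomputable def coveringDim (X : Type u) [TopologicalSpace X] : WithBot ℕ∞ :=
  if IsEmpty X then ⊥ else ⨅ (n : ℕ) (_ : HasCoveringDimLE X n), ((n : ℕ∞) : WithBot ℕ∞)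

end TopCard

namespace TopCard

/-! ### Subcontinua and totally disconnected closed sets -/

variable {X : Type u} [TopologicalSpace X]

/-! Boundary bumping (`nontrivial_connectedComponentIn`) produces non-degenerate continua inside
every non-empty open set, and disjoint ones are counted by `Sln`. Weights are bounded by counting
continuous functions that separate points. Rim-weight and dimension: of the continuum many level
sets of a Urysohn function, one contains no non-degenerate continuum, since `Sln < 𝔠`. So there is a
base with totally disconnected boundaries. Such a closed set `Z` has weight at most `Sln`: a maximal
disjoint family of continua missing `Z` yields few neighbourhoods of `Z` with totally disconnected
intersection. Disjoint open families, one covering the boundaries and one their complement, give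
`dim ≤ 1`. `w ≤ Sln⁺`: a recursion of length `Sln⁺` adds functions that are non-constant on each
non-degenerate component of the current fibres. A continuum surviving all stages would yield `Sln⁺`
disjoint continua, so the final fibres are totally disconnected, and few further functions separate
their points. `Sln ≤ hl`: a disjoint family larger than `hl` contains a dense-in-itself part, and a
Cantor scheme then builds continuum many disjoint continua. -/

lemma exists_isClopen_of_connectedComponent_subset [CompactSpace X] [T2Space X] {x : X} {U : Set X}
    (hU : IsOpen U) (h : connectedComponent x ⊆ U) : ∃ Q, IsClopen Q ∧ x ∈ Q ∧ Q ⊆ U := by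
  rw [connectedComponent_eq_iInter_isClopen] at h
  have : Nonempty {s : Set X // IsClopen s ∧ x ∈ s} := ⟨⟨univ, isClopen_univ, mem_univ x⟩⟩
  obtain ⟨⟨Q, hQ⟩, hQU⟩ := exists_subset_nhds_of_compactSpace
    (V := fun s : {s : Set X // IsClopen s ∧ x ∈ s} => s.1)
    (fun a b => ⟨⟨a.1 ∩ b.1, a.2.1.inter b.2.1, a.2.2, b.2.2⟩, inter_subset_left,
      inter_subset_right⟩)
    (fun s => s.2.1.isClosed) (fun y hy => hU.mem_nhds (h hy))
  exact ⟨Q, hQ.1, hQ.2, hQU⟩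

/-- In a non-degenerate continuum, the component of an interior point of a closed set `N` in `N`
is non-degenerate. -/
lemma nontrivial_connectedComponentIn [CompactSpace X] [T2Space X] [ConnectedSpace X]
    [Nontrivial X] {N : Set X} (hN : IsClosed N) {x : X} (hx : x ∈ interior N) :
    (connectedComponentIn N x).Nontrivial := by
  have hxN : x ∈ N := interior_subset hx
  obtain ⟨y, hy⟩ := exists_ne x
  by_contra hns
  rw [not_nontrivial_iff] at hns
  have : CompactSpace N := isCompact_iff_compactSpace.mp hN.isCompact
  -- If the component were `{x}`, some clopen subset of `N` containing `x` would lie in the interior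
  -- of `N` and miss `y`. It would then be clopen in `X`, against connectedness.
  have hU : IsOpen (interior N ∩ {y}ᶜ) := isOpen_interior.inter isOpen_compl_singleton
  have hsub : connectedComponent (⟨x, hxN⟩ : N) ⊆ (↑) ⁻¹' (interior N ∩ {y}ᶜ) := by
    intro z hz
    have hz' : (z : X) ∈ connectedComponentIn N x := by
      rw [connectedComponentIn_eq_image hxN]
      exact ⟨z, hz, rfl⟩
    rw [mem_preimage, hns hz' (mem_connectedComponentIn hxN)]
    exact ⟨hx, hy.symm⟩
  obtain ⟨Q, hQ, hxQ, hQU⟩ := exists_isClopen_of_connectedComponent_subset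
    (hU.preimage continuous_subtype_val) hsub
  have hQc : IsClosed ((↑) '' Q : Set X) := hN.isClosedMap_subtype_val Q hQ.isClosed
  have hQo : IsOpen ((↑) '' Q : Set X) := by
    obtain ⟨O, hO, rfl⟩ := isOpen_induced_iff.mp hQ.isOpen
    have : ((↑) '' ((↑) ⁻¹' O : Set N) : Set X) = O ∩ interior N := by
      rw [Subtype.image_preimage_coe]
      ext z
      constructor
      · rintro ⟨h1, h2⟩
        exact ⟨h2, (hQU (a := ⟨z, h1⟩) h2).1⟩
      · rintro ⟨h1, h2⟩
        exact ⟨interior_subset h2, h1⟩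
    rw [this]
    exact hO.inter isOpen_interior
  have := (IsClopen.eq_univ ⟨hQc, hQo⟩ ⟨x, ⟨x, hxN⟩, hxQ, rfl⟩)
  obtain ⟨z, hz, hzy⟩ : y ∈ ((↑) '' Q : Set X) := this ▸ mem_univ y
  exact (hQU hz).2 hzy

/-- A set that is a non-degenerate continuum in the subspace topology of a Hausdorff space. -/
def IsNondegenerateContinuum (C : Set X) : Prop :=
  IsCompact C ∧ IsConnected C ∧ C.Nontrivial

lemma isClosed_connectedComponentIn {N : Set X} (hN : IsClosed N) (x : X) :
    IsClosed (connectedComponentIn N x) := by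
  by_cases hx : x ∈ N
  · rw [connectedComponentIn_eq_image hx]
    exact hN.isClosedMap_subtype_val _ isClosed_connectedComponent
  · rw [connectedComponentIn_eq_empty hx]
    exact isClosed_empty

lemma isNondegenerateContinuum_connectedComponentIn [CompactSpace X] [T2Space X]
    [ConnectedSpace X] [Nontrivial X] {N : Set X} (hN : IsClosed N) {x : X}
    (hx : x ∈ interior N) : IsNondegenerateContinuum (connectedComponentIn N x) :=
  ⟨(isClosed_connectedComponentIn hN x).isCompact, isConnected_connectedComponentIn_iff.mpr
    (interior_subset hx), nontrivial_connectedComponentIn hN hx⟩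

/-- A non-degenerate continuum meeting an open set contains a non-degenerate continuum inside this
open set. -/
lemma IsNondegenerateContinuum.exists_subset_inter [T2Space X] {K U : Set X}
    (hK : IsNondegenerateContinuum K) (hU : IsOpen U) (h : (K ∩ U).Nonempty) :
    ∃ L ⊆ K ∩ U, IsNondegenerateContinuum L := by
  obtain ⟨x, hxK, hxU⟩ := h
  have : CompactSpace K := isCompact_iff_compactSpace.mp hK.1
  have : ConnectedSpace K := Subtype.connectedSpace hK.2.1
  have : Nontrivial K := hK.2.2.coe_sort
  have hU' : IsOpen ((↑) ⁻¹' U : Set K) := hU.preimage continuous_subtype_val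
  obtain ⟨N, hN, hNc, hNU⟩ := exists_mem_nhds_isClosed_subset (hU'.mem_nhds (x := ⟨x, hxK⟩) hxU)
  have hC := isNondegenerateContinuum_connectedComponentIn hNc (mem_interior_iff_mem_nhds.mpr hN)
  refine ⟨(↑) '' (connectedComponentIn N (⟨x, hxK⟩ : K)), ?_, hC.1.image continuous_subtype_val,
    hC.2.1.image _ continuous_subtype_val.continuousOn,
    hC.2.2.image Subtype.val_injective⟩
  rintro _ ⟨z, hz, rfl⟩
  exact ⟨z.2, hNU (connectedComponentIn_subset _ _ hz)⟩

lemma exists_isNondegenerateContinuum_subset [CompactSpace X] [T2Space X] [ConnectedSpace X]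
    [Nontrivial X] {U : Set X} (hU : IsOpen U) (h : U.Nonempty) :
    ∃ L ⊆ U, IsNondegenerateContinuum L := by
  obtain ⟨L, hL, hL'⟩ := IsNondegenerateContinuum.exists_subset_inter (K := (univ : Set X))
    ⟨isCompact_univ, isConnected_univ, nontrivial_univ⟩ hU (by simpa using h)
  exact ⟨L, hL.trans inter_subset_right, hL'⟩

/-- A closed subset of a compact Hausdorff space that contains no non-degenerate continuum is
totally disconnected. -/
lemma isTotallyDisconnected_of_forall_not [CompactSpace X] {Z : Set X}
    (hZ : IsClosed Z) (h : ∀ K ⊆ Z, ¬ IsNondegenerateContinuum K) : IsTotallyDisconnected Z := by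
  intro t htZ ht
  by_contra hn
  rw [not_subsingleton_iff] at hn
  exact h (closure t) (hZ.closure_subset_iff.mpr htZ) ⟨isClosed_closure.isCompact,
    ⟨hn.nonempty.closure, ht.closure⟩, hn.mono subset_closure⟩

lemma _root_.IsTotallyDisconnected.not_isNondegenerateContinuum {Z K : Set X}
    (hZ : IsTotallyDisconnected Z) (hK : K ⊆ Z) : ¬ IsNondegenerateContinuum K := fun h =>
  not_nontrivial_iff.mpr (hZ K hK h.2.1.isPreconnected) h.2.2

/-- A continuum in the union that is not inside `A` contains a smaller one in the open complement of
`A`, hence inside `B`. -/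
lemma _root_.IsTotallyDisconnected.union [CompactSpace X] [T2Space X] {A B : Set X}
    (hA : IsTotallyDisconnected A) (hB : IsTotallyDisconnected B) (hAc : IsClosed A)
    (hBc : IsClosed B) : IsTotallyDisconnected (A ∪ B) := by
  refine isTotallyDisconnected_of_forall_not (hAc.union hBc) fun K hK hKn => ?_
  by_cases h : (K ∩ Aᶜ).Nonempty
  · obtain ⟨L, hL, hLn⟩ := hKn.exists_subset_inter hAc.isOpen_compl h
    exact hB.not_isNondegenerateContinuum
      (fun x hx => (hK (hL hx).1).resolve_left (hL hx).2) hLn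
  · refine hA.not_isNondegenerateContinuum (fun x hx => ?_) hKn
    by_contra hxA
    exact h ⟨x, hx, hxA⟩

/-! ### Counting with the Suslinian number, and weight via separating functions -/

/-- The index universe is free so that families indexed by naturals, reals or binary sequences can
be counted. -/
lemma lift_mk_le_suslinianNumber {ι : Type*} (K : ι → Set X)
    (hK : ∀ i, IsNondegenerateContinuum (K i)) (hd : Pairwise (Function.onFun Disjoint K)) :
    Cardinal.lift.{u} #ι ≤ Cardinal.lift (suslinianNumber X) := by
  have hinj : Function.Injective K := by
    intro i j hij
    by_contra hne
    have := hd hne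
    rw [Function.onFun, hij, disjoint_self] at this
    exact (hK j).2.1.nonempty.ne_empty this
  rw [← Cardinal.mk_range_eq_of_injective hinj, Cardinal.lift_le]
  refine le_ciSup (f := fun 𝒞 : {𝒞 : Set (Set X) // IsDisjointFamilyOfSubcontinua 𝒞} => #𝒞.1)
    Cardinal.bddAbove_of_small ⟨range K, ?_, ?_⟩
  · rintro _ ⟨i, rfl⟩
    exact hK i
  · rintro _ ⟨i, rfl⟩ _ ⟨j, rfl⟩ hne
    exact hd fun h => hne (h ▸ rfl)

lemma mk_le_suslinianNumber {ι : Type u} (K : ι → Set X)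
    (hK : ∀ i, IsNondegenerateContinuum (K i)) (hd : Pairwise (Function.onFun Disjoint K)) :
    #ι ≤ suslinianNumber X := by
  simpa using lift_mk_le_suslinianNumber K hK hd

lemma aleph0_le_suslinianNumber [CompactSpace X] [T2Space X] [ConnectedSpace X] [Nontrivial X] :
    ℵ₀ ≤ suslinianNumber X := by
  have : Infinite X := PreconnectedSpace.infinite
  obtain ⟨U, hUi, hUo, hd⟩ := exists_seq_infinite_isOpen_pairwise_disjoint X
  choose L hLU hL using fun n => exists_isNondegenerateContinuum_subset (hUo n) (hUi n).nonempty
  simpa using lift_mk_le_suslinianNumber L hL fun i j hij => (hd hij).mono (hLU i) (hLU j)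

lemma mk_finset_le {ι : Type u} {μ : Cardinal.{u}} (hμ : ℵ₀ ≤ μ) (h : #ι ≤ μ) :
    #(Finset ι) ≤ μ := by
  cases finite_or_infinite ι
  · exact (Cardinal.mk_lt_aleph0 (α := Finset ι)).le.trans hμ
  · rwa [Cardinal.mk_finset_of_infinite]

lemma mk_iUnion_le_of_le {ι α : Type u} {S : ι → Set α} {μ : Cardinal.{u}} (hμ : ℵ₀ ≤ μ)
    (hι : #ι ≤ μ) (hS : ∀ i, #(S i) ≤ μ) : #(⋃ i, S i) ≤ μ :=
  (Cardinal.mk_iUnion_le _).trans <|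
    (mul_le_mul' hι (ciSup_le' hS)).trans (Cardinal.mul_eq_self hμ).le

lemma weight_le_mk {B : Set (Set X)} (hB : IsTopologicalBasis B) : weight X ≤ #B :=
  csInf_le' ⟨B, hB, rfl⟩

variable (X) in
lemma exists_isTopologicalBasis_mk_eq_weight :
    ∃ B : Set (Set X), IsTopologicalBasis B ∧ #B = weight X := by
  obtain ⟨B, hB, h⟩ := csInf_mem (s := {κ | ∃ B : Set (Set X), IsTopologicalBasis B ∧ κ = #B})
    ⟨_, _, isTopologicalBasis_opens, rfl⟩
  exact ⟨B, hB, h.symm⟩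

lemma exists_isTopologicalBasis_of_eq_generateFrom {s : Set (Set X)} {μ : Cardinal.{u}}
    (hμ : ℵ₀ ≤ μ) (hs : #s ≤ μ) (h : ‹TopologicalSpace X› = generateFrom s) :
    ∃ B : Set (Set X), IsTopologicalBasis B ∧ #B ≤ μ := by
  refine ⟨_, isTopologicalBasis_of_subbasis h, ?_⟩
  refine le_trans ?_ (mk_finset_le hμ hs)
  refine le_trans (Cardinal.mk_le_mk_of_subset (t := range fun f : Finset s =>
    ⋂₀ ((↑) '' (f : Set s))) ?_) Cardinal.mk_range_le
  rintro _ ⟨f, ⟨hf, hfs⟩, rfl⟩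
  lift f to Set s using hfs
  have hf' : f.Finite := hf.of_finite_image Subtype.val_injective.injOn
  exact ⟨hf'.toFinset, by simp⟩

/-- A compact Hausdorff space whose points are separated by `μ` many continuous functions has
weight at most `μ`. -/
lemma weight_le_of_separating [CompactSpace X] [T2Space X] {S : Set C(X, ℝ)} {μ : Cardinal.{u}}
    (hμ : ℵ₀ ≤ μ) (hS : #S ≤ μ) (h : ∀ x y : X, x ≠ y → ∃ g ∈ S, g x ≠ g y) : weight X ≤ μ := by
  -- The diagonal map embeds `X` in `ℝ^S`, so preimages of rational intervals form a subbase.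
  let e : X → S → ℝ := fun x g => g.1 x
  have he : Topology.IsClosedEmbedding e := by
    refine Continuous.isClosedEmbedding (continuous_pi fun g => g.1.continuous) fun x y hxy => ?_
    by_contra hne
    obtain ⟨g, hg, hgxy⟩ := h x y hne
    exact hgxy (congrFun hxy ⟨g, hg⟩)
  have htop : ‹TopologicalSpace X› = generateFrom
      (⋃ g : S, preimage (g.1 : X → ℝ) '' ⋃ (a : ℚ) (b : ℚ) (_ : a < b), {Ioo (a : ℝ) b}) := by
    refine he.eq_induced.trans ?_
    rw [Pi.topologicalSpace, induced_iInf, generateFrom_iUnion]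
    congr 1
    ext1 g
    rw [induced_compose, ← induced_generateFrom_eq,
      ← Real.isTopologicalBasis_Ioo_rat.eq_generateFrom]
    rfl
  have hcount : ∀ g : S, #(preimage (g.1 : X → ℝ) '' ⋃ (a : ℚ) (b : ℚ) (_ : a < b),
      {Ioo (a : ℝ) b} : Set (Set X)) ≤ μ := fun g =>
    (Countable.image (countable_iUnion fun a => countable_iUnion fun b =>
      countable_iUnion fun _ => countable_singleton _) _).le_aleph0.trans hμ
  obtain ⟨B, hB, hBμ⟩ := exists_isTopologicalBasis_of_eq_generateFrom hμ
    (mk_iUnion_le_of_le hμ hS hcount) htop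
  exact (weight_le_mk hB).trans hBμ

/-- The fibre through `x` of the diagonal product of a family of functions. -/
def fibre (S : Set C(X, ℝ)) (x : X) : Set X := {y | ∀ g ∈ S, g y = g x}

lemma isClosed_fibre (S : Set C(X, ℝ)) (x : X) : IsClosed (fibre S x) := by
  have : fibre S x = ⋂ g ∈ S, {y | g y = g x} := by ext; simp [fibre]
  rw [this]
  exact isClosed_biInter fun g _ => isClosed_eq g.continuous continuous_const

lemma fibre_eq_of_mem {S : Set C(X, ℝ)} {x y : X} (h : y ∈ fibre S x) :
    fibre S y = fibre S x := by
  ext z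
  exact forall₂_congr fun g hg => by rw [h g hg]

/-- Fibres partition `X`, so their non-degenerate components are pairwise disjoint and number at
most `Sln`, however large `S` is. One function that is non-constant on each suffices. -/
lemma exists_refining_family [CompactSpace X] [T2Space X] (S : Set C(X, ℝ)) : ∃ T : Set C(X, ℝ), #T ≤ suslinianNumber X ∧
    ∀ x, (connectedComponentIn (fibre S x) x).Nontrivial →
      ∃ g ∈ T, ∃ a ∈ connectedComponentIn (fibre S x) x, g a ≠ g x := by
  let D : Set (Set X) := {C | C.Nontrivial ∧ ∃ x, C = connectedComponentIn (fibre S x) x}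
  have hmem : ∀ x : X, x ∈ connectedComponentIn (fibre S x) x := fun x =>
    mem_connectedComponentIn fun g _ => rfl
  have hD : #D ≤ suslinianNumber X := by
    refine mk_le_suslinianNumber (fun C : D => C.1) ?_ ?_
    · rintro ⟨_, hC, x, rfl⟩
      exact ⟨(isClosed_connectedComponentIn (isClosed_fibre S x) x).isCompact,
        ⟨⟨x, hmem x⟩, isPreconnected_connectedComponentIn⟩, hC⟩
    · rintro ⟨_, hC, x, rfl⟩ ⟨_, hC', y, rfl⟩ hne
      refine disjoint_left.mpr fun z hzx hzy => hne (Subtype.ext ?_)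
      have h1 := fibre_eq_of_mem (connectedComponentIn_subset _ _ hzx)
      have h2 := fibre_eq_of_mem (connectedComponentIn_subset _ _ hzy)
      change connectedComponentIn (fibre S x) x = connectedComponentIn (fibre S y) y
      rw [connectedComponentIn_eq hzx, connectedComponentIn_eq hzy, ← h1, ← h2]
  have key : ∀ C : D, ∃ g : C(X, ℝ), ∃ a ∈ C.1, ∃ b ∈ C.1, g a ≠ g b := by
    rintro ⟨C, ⟨a, ha, b, hb, hab⟩, -⟩
    obtain ⟨g, h0, h1, -⟩ := exists_continuous_zero_one_of_isClosed (isClosed_singleton (x := a))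
      (isClosed_singleton (x := b)) (disjoint_singleton.mpr hab)
    refine ⟨g, a, ha, b, hb, ?_⟩
    rw [h0 rfl, h1 rfl]
    simp
  choose g hg using key
  refine ⟨range g, Cardinal.mk_range_le.trans hD, fun x hx => ⟨_, ⟨⟨_, hx, x, rfl⟩, rfl⟩, ?_⟩⟩
  obtain ⟨a, ha, b, hb, hab⟩ := hg ⟨_, hx, x, rfl⟩
  by_contra! hcon
  exact hab ((hcon a ha).trans (hcon b hb).symm)

/-! ### Upper bounds for the weight -/

section Separation

variable [CompactSpace X] [T2Space X] [ConnectedSpace X] [Nontrivial X] {μ : Cardinal.{u}}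

/-- The components of a closed set that meet its interior are separated by at most
`suslinianNumber X` many continuous functions. -/
lemma exists_separating_components (hμ : suslinianNumber X ≤ μ) {N : Set X} (hN : IsClosed N) :
    ∃ S : Set C(X, ℝ), #S ≤ μ ∧ ∀ x ∈ interior N, ∀ y ∈ interior N,
      connectedComponentIn N x ≠ connectedComponentIn N y → ∃ g ∈ S, g x ≠ g y := by
  have hμ' : ℵ₀ ≤ μ := aleph0_le_suslinianNumber.trans hμ
  let D : Set (Set X) := connectedComponentIn N '' interior N
  have hdisj : ∀ x y : X, connectedComponentIn N x ≠ connectedComponentIn N y →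
      Disjoint (connectedComponentIn N x) (connectedComponentIn N y) := by
    intro x y hne
    rw [Set.disjoint_left]
    intro z hzx hzy
    exact hne ((connectedComponentIn_eq hzx).trans (connectedComponentIn_eq hzy).symm)
  -- Boundary bumping makes components through interior points non-degenerate, so `Sln` counts them.
  have hD : #D ≤ μ := by
    refine (mk_le_suslinianNumber (fun C : D => C.1) ?_ ?_).trans hμ
    · rintro ⟨_, x, hx, rfl⟩
      exact isNondegenerateContinuum_connectedComponentIn hN hx
    · rintro ⟨_, x, hx, rfl⟩ ⟨_, y, hy, rfl⟩ hne
      exact hdisj x y fun h => hne (Subtype.ext h)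
  have key : ∀ p : D × D, ∃ g : C(X, ℝ), p.1 ≠ p.2 → EqOn g 0 p.1.1 ∧ EqOn g 1 p.2.1 := by
    rintro ⟨⟨_, x, hx, rfl⟩, ⟨_, y, hy, rfl⟩⟩
    by_cases h : connectedComponentIn N x = connectedComponentIn N y
    · exact ⟨0, fun hne => (hne (Subtype.ext h)).elim⟩
    · obtain ⟨g, h0, h1, -⟩ := exists_continuous_zero_one_of_isClosed
        (isClosed_connectedComponentIn hN x) (isClosed_connectedComponentIn hN y) (hdisj x y h)
      exact ⟨g, fun _ => ⟨h0, h1⟩⟩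
  choose g hg using key
  refine ⟨range g, Cardinal.mk_range_le.trans ?_, fun x hx y hy hne => ?_⟩
  · rw [Cardinal.mk_prod, Cardinal.lift_id]
    exact (mul_le_mul' hD hD).trans (Cardinal.mul_eq_self hμ').le
  · obtain ⟨h0, h1⟩ := hg (⟨_, mem_image_of_mem _ hx⟩, ⟨_, mem_image_of_mem _ hy⟩)
      fun h => hne (congrArg Subtype.val h)
    refine ⟨g (⟨_, mem_image_of_mem _ hx⟩, ⟨_, mem_image_of_mem _ hy⟩), mem_range_self _, ?_⟩
    rw [h0 (mem_connectedComponentIn (interior_subset hx)),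
      h1 (mem_connectedComponentIn (interior_subset hy))]
    simp

/-- Given `μ` many closed sets, there are `μ` many continuous functions which separate any two
points lying in the interiors of a subfamily with a totally disconnected intersection. -/
lemma exists_separating_of_isTotallyDisconnected_iInter (hμ : suslinianNumber X ≤ μ)
    {ι : Type u} (hι : #ι ≤ μ) {N : ι → Set X} (hN : ∀ i, IsClosed (N i)) :
    ∃ S : Set C(X, ℝ), #S ≤ μ ∧ ∀ (J : Set ι) (x y : X), (∀ i ∈ J, x ∈ interior (N i)) →
      (∀ i ∈ J, y ∈ interior (N i)) → IsTotallyDisconnected (⋂ i ∈ J, N i) → x ≠ y →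
      ∃ g ∈ S, g x ≠ g y := by
  have hμ' : ℵ₀ ≤ μ := aleph0_le_suslinianNumber.trans hμ
  have hNs : ∀ s : Finset ι, IsClosed (⋂ i ∈ s, N i) := fun s =>
    isClosed_biInter fun i _ => hN i
  choose S hS hsep using fun s : Finset ι => exists_separating_components hμ (hNs s)
  refine ⟨⋃ s, S s, mk_iUnion_le_of_le hμ' (mk_finset_le hμ' hι) hS,
    fun J x y hx hy hJ hxy => ?_⟩
  -- There are only `μ` finite intersections, so it is enough that one of them already puts `x` and
  -- `y` in different components.
  suffices ∃ s : Finset ι, ↑s ⊆ J ∧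
      connectedComponentIn (⋂ i ∈ s, N i) x ≠ connectedComponentIn (⋂ i ∈ s, N i) y by
    obtain ⟨s, hsJ, hne⟩ := this
    have hint : ∀ z, (∀ i ∈ J, z ∈ interior (N i)) → z ∈ interior (⋂ i ∈ s, N i) := by
      intro z hz
      rw [Finset.interior_iInter]
      exact mem_iInter₂.mpr fun i hi => hz i (hsJ hi)
    obtain ⟨g, hg, hgne⟩ := hsep s x (hint x hx) y (hint y hy) hne
    exact ⟨g, mem_iUnion.mpr ⟨s, hg⟩, hgne⟩
  set M : Set X := ⋂ i ∈ J, N i with hM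
  have hMc : IsClosed M := isClosed_biInter fun i _ => hN i
  have : CompactSpace M := isCompact_iff_compactSpace.mp hMc.isCompact
  have : TotallyDisconnectedSpace M :=
    totallyDisconnectedSpace_subtype_iff.mpr hJ
  have hxM : x ∈ M := mem_iInter₂.mpr fun i hi => interior_subset (hx i hi)
  have hyM : y ∈ M := mem_iInter₂.mpr fun i hi => interior_subset (hy i hi)
  -- A clopen splitting of `M` extends to disjoint open sets `U`, `V` of `X`. By compactness a
  -- finite intersection already lies in `U ∪ V`, and the component of `x` there stays in `U`.
  obtain ⟨P, hP, hxP, hyP⟩ := exists_isClopen_of_totally_separated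
    (fun h => hxy (congrArg Subtype.val h) : (⟨x, hxM⟩ : M) ≠ ⟨y, hyM⟩)
  obtain ⟨U, V, hU, hV, hPU, hPV, hUV⟩ := normal_separation
    (hMc.isClosedMap_subtype_val P hP.isClosed) (hMc.isClosedMap_subtype_val Pᶜ
      hP.isOpen.isClosed_compl) ((disjoint_image_iff Subtype.val_injective).mpr disjoint_compl_right)
  have hMUV : M ⊆ U ∪ V := by
    intro z hz
    by_cases hzP : (⟨z, hz⟩ : M) ∈ P
    · exact Or.inl (hPU ⟨_, hzP, rfl⟩)
    · exact Or.inr (hPV ⟨_, hzP, rfl⟩)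
  obtain ⟨t, ht⟩ := (hU.union hV).isClosed_compl.isCompact.elim_finite_subfamily_closed
    (fun i : J => N i) (fun i => hN i) (by
      rw [← disjoint_iff_inter_eq_empty, disjoint_compl_left_iff_subset, iInter_subtype]
      exact hMUV)
  classical
  refine ⟨t.image Subtype.val, by simp, fun heq => ?_⟩
  set A := ⋂ i ∈ t.image Subtype.val, N i with hA
  have hAM : M ⊆ A := by
    refine subset_iInter₂ fun i hi => biInter_subset_of_mem ?_
    obtain ⟨j, -, rfl⟩ := Finset.mem_image.mp hi
    exact j.2
  have hAUV : A ⊆ U ∪ V := by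
    rw [← disjoint_iff_inter_eq_empty, disjoint_compl_left_iff_subset] at ht
    refine subset_trans (fun z hz => ?_) ht
    refine mem_iInter₂.mpr fun i hi => ?_
    exact mem_iInter₂.mp hz i.1 (Finset.mem_image_of_mem _ hi)
  have hyA : y ∈ connectedComponentIn A x := heq ▸ mem_connectedComponentIn (hAM hyM)
  have hsub := isPreconnected_connectedComponentIn.subset_left_of_subset_union hU hV hUV
    ((connectedComponentIn_subset A x).trans hAUV)
    ⟨x, mem_connectedComponentIn (hAM hxM), hPU ⟨_, hxP, rfl⟩⟩
  exact disjoint_left.mp hUV (hsub hyA) (hPV ⟨_, hyP, rfl⟩)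

/-- A closed totally disconnected set in a continuum `X` has weight at most `suslinianNumber X`. -/
lemma weight_le_suslinianNumber_of_isTotallyDisconnected {Z : Set X} (hZ : IsClosed Z)
    (hZt : IsTotallyDisconnected Z) : weight Z ≤ suslinianNumber X := by
  obtain ⟨𝒞, h𝒞⟩ := zorn_subset {𝒞 : Set (Set X) | (∀ C ∈ 𝒞, IsNondegenerateContinuum C ∧
      Disjoint C Z) ∧ 𝒞.PairwiseDisjoint id} (by
    intro c hc hchain
    refine ⟨⋃₀ c, ⟨?_, ?_⟩, fun s hs => subset_sUnion_of_mem hs⟩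
    · rintro C ⟨s, hs, hCs⟩
      exact (hc hs).1 C hCs
    · exact (pairwiseDisjoint_sUnion hchain.directedOn).mpr fun s hs => (hc hs).2)
  obtain ⟨h𝒞1, h𝒞2⟩ := h𝒞.prop
  have hcard : #𝒞 ≤ suslinianNumber X :=
    mk_le_suslinianNumber (fun C : 𝒞 => C.1) (fun C => (h𝒞1 C.1 C.2).1)
      fun C D hne => h𝒞2 C.2 D.2 fun h => hne (Subtype.ext h)
  have hnhds : ∀ C : 𝒞, ∃ N : Set X, IsClosed N ∧ Z ⊆ interior N ∧ Disjoint N C := by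
    intro C
    obtain ⟨V, hV, hZV, hVC⟩ := normal_exists_closure_subset hZ
      (h𝒞1 C.1 C.2).1.1.isClosed.isOpen_compl
      (subset_compl_iff_disjoint_left.mpr (h𝒞1 C.1 C.2).2)
    exact ⟨closure V, isClosed_closure, hZV.trans (interior_maximal subset_closure hV),
      subset_compl_iff_disjoint_right.mp hVC⟩
  choose N hN hZN hNC using hnhds
  obtain ⟨S, hS, hsep⟩ := exists_separating_of_isTotallyDisconnected_iInter le_rfl hcard hN
  -- A continuum in the intersection would contain one, `L`, off `Z`. It misses every member of `𝒞`,
  -- so maximality puts it in `𝒞`, making it disjoint from itself.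
  have hM : IsTotallyDisconnected (⋂ C ∈ (univ : Set 𝒞), N C) := by
    refine isTotallyDisconnected_of_forall_not (isClosed_biInter fun C _ => hN C)
      fun K hK hKn => ?_
    have hKZ : (K ∩ Zᶜ).Nonempty := by
      by_contra h
      refine hZt.not_isNondegenerateContinuum (fun z hz => ?_) hKn
      by_contra hzZ
      exact h ⟨z, hz, hzZ⟩
    obtain ⟨L, hL, hLn⟩ := hKn.exists_subset_inter hZ.isOpen_compl hKZ
    have hLC : ∀ C ∈ 𝒞, Disjoint L C := fun C hC =>
      (hNC ⟨C, hC⟩).mono_left fun z hz => mem_iInter₂.mp (hK (hL hz).1) ⟨C, hC⟩ (mem_univ _)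
    have hmem : L ∈ 𝒞 := by
      refine h𝒞.le_of_ge (y := insert L 𝒞) ⟨?_, ?_⟩ (subset_insert _ _) (mem_insert _ _)
      · rintro C (rfl | hC)
        · exact ⟨hLn, disjoint_left.mpr fun z hz => (hL hz).2⟩
        · exact h𝒞1 C hC
      · exact h𝒞2.insert fun C hC _ => hLC C hC
    exact hLn.2.1.nonempty.ne_empty (disjoint_self.mp (hLC L hmem))
  have : CompactSpace Z := isCompact_iff_compactSpace.mp hZ.isCompact
  refine weight_le_of_separating (S := (fun g : C(X, ℝ) => g.restrict Z) '' S)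
    aleph0_le_suslinianNumber (Cardinal.mk_image_le.trans hS) fun x y hxy => ?_
  obtain ⟨g, hg, hne⟩ := hsep univ x y (fun C _ => hZN C x.2) (fun C _ => hZN C y.2) hM
    fun h => hxy (Subtype.ext h)
  exact ⟨_, mem_image_of_mem _ hg, hne⟩

/-- If the fibres of the diagonal product of `μ` many functions are totally disconnected, then the
weight of `X` is at most `μ`. -/
lemma weight_le_of_isTotallyDisconnected_fibre (hμ : suslinianNumber X ≤ μ) {S : Set C(X, ℝ)}
    (hS : #S ≤ μ) (h : ∀ x, IsTotallyDisconnected (fibre S x)) : weight X ≤ μ := by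
  have hμ' : ℵ₀ ≤ μ := aleph0_le_suslinianNumber.trans hμ
  obtain ⟨T, hT, hsep⟩ := exists_separating_of_isTotallyDisconnected_iInter hμ
    (ι := S × (ℚ × ℚ)) (N := fun p => p.1.1 ⁻¹' Icc (p.2.1 : ℝ) p.2.2) (by
      rw [Cardinal.mk_prod]
      refine (mul_le_mul' (?_ : _ ≤ μ) (?_ : _ ≤ μ)).trans (Cardinal.mul_eq_self hμ').le
      · simpa using hS
      · simpa using hμ') (fun p => isClosed_Icc.preimage p.1.1.continuous)
  refine weight_le_of_separating hμ' (S := S ∪ T) ((Cardinal.mk_union_le _ _).trans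
    ((add_le_add hS hT).trans (Cardinal.add_eq_self hμ').le)) fun x y hxy => ?_
  by_cases hS' : ∃ g ∈ S, g x ≠ g y
  · obtain ⟨g, hg, hne⟩ := hS'
    exact ⟨g, Or.inl hg, hne⟩
  push Not at hS'
  have hint : ∀ (p : S × (ℚ × ℚ)) (z : X), p.1.1 z ∈ Ioo (p.2.1 : ℝ) p.2.2 →
      z ∈ interior (p.1.1 ⁻¹' Icc (p.2.1 : ℝ) p.2.2) := fun p z hz =>
    interior_maximal (preimage_mono Ioo_subset_Icc_self)
      (isOpen_Ioo.preimage p.1.1.continuous) hz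
  -- The slabs chosen are those with `g x` strictly between the rational bounds. Their intersection
  -- lies in the fibre of `x`, and `y` is interior to them too, as `S` does not separate it from
  -- `x`.
  obtain ⟨g, hg, hne⟩ := hsep {p | p.1.1 x ∈ Ioo (p.2.1 : ℝ) p.2.2} x y (fun p hp => hint p x hp)
    (fun p hp => hint p y (by rw [← hS' _ p.1.2]; exact hp)) (by
      intro t ht
      refine h x t fun z hz g hg => ?_
      have hmem : ∀ q r : ℚ, (q : ℝ) < g x → g x < r → g z ∈ Icc (q : ℝ) r := fun q r hq hr =>
        mem_iInter₂.mp (ht hz) (⟨g, hg⟩, (q, r)) ⟨hq, hr⟩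
      obtain ⟨q, hq⟩ := exists_rat_lt (g x)
      obtain ⟨r, hr⟩ := exists_rat_gt (g x)
      refine le_antisymm (le_of_forall_lt_rat_imp_le fun r' hr' => ?_)
        (le_of_forall_rat_lt_imp_le fun q' hq' => ?_)
      · exact (hmem q r' hq hr').2
      · exact (hmem q' r hq' hr).1) hxy
  exact ⟨g, Or.inr hg, hne⟩

/-- The weight of a continuum is at most the successor of its Suslinian number. -/
lemma weight_le_succ_suslinianNumber : weight X ≤ Order.succ (suslinianNumber X) := by
  choose step hstep hsplit using exists_refining_family (X := X)
  let ι : Type u := (Order.succ (suslinianNumber X)).ord.ToType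
  have hι : #ι = Order.succ (suslinianNumber X) := Cardinal.mk_ord_toType _
  -- Stage `i` collects all functions added at earlier stages.
  let F : ι → Set C(X, ℝ) := WellFoundedLT.fix
    fun i f => ⋃ (j : ι) (h : j < i), step (f j h)
  have hF : ∀ i, F i = ⋃ (j : ι) (_ : j < i), step (F j) := fun i =>
    WellFoundedLT.fix_eq _ i
  have hle : suslinianNumber X ≤ Order.succ (suslinianNumber X) := Order.le_succ _
  refine weight_le_of_isTotallyDisconnected_fibre (S := ⋃ i, step (F i)) hle
    (mk_iUnion_le_of_le (aleph0_le_suslinianNumber.trans hle) hι.le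
      fun i => (hstep _).trans hle) fun x => ?_
  refine isTotallyDisconnected_of_forall_not (isClosed_fibre _ _) fun K hK hKn => ?_
  obtain ⟨x₀, hx₀⟩ := hKn.2.1.nonempty
  have hKF : ∀ i, K ⊆ fibre (F i) x₀ := by
    intro i z hz g hg
    rw [hF] at hg
    obtain ⟨j, hj, hgj⟩ := mem_iUnion₂.mp hg
    have hgS := mem_iUnion (s := fun i => step (F i)).mpr ⟨j, hgj⟩
    rw [hK hz g hgS, hK hx₀ g hgS]
  let C : ι → Set X := fun i => connectedComponentIn (fibre (F i) x₀) x₀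
  have hKC : ∀ i, K ⊆ C i := fun i =>
    hKn.2.1.isPreconnected.subset_connectedComponentIn hx₀ (hKF i)
  have hC : ∀ i, IsNondegenerateContinuum (C i) := fun i =>
    ⟨(isClosed_connectedComponentIn (isClosed_fibre _ _) _).isCompact,
      ⟨⟨x₀, hKC i hx₀⟩, isPreconnected_connectedComponentIn⟩, hKn.2.2.mono (hKC i)⟩
  choose g hg a ha hga using fun i => hsplit (F i) x₀ (hC i).2.2
  -- `L i` lives where `g i` differs from its value at `x₀`, while every later component lies in a
  -- fibre on which `g i` keeps that value. Hence the `L i` are disjoint.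
  choose L hL hLn using fun i => (hC i).exists_subset_inter (U := {y | g i y ≠ g i x₀})
    (isOpen_ne_fun (g i).continuous continuous_const) ⟨a i, ha i, hga i⟩
  have hdisj : ∀ i j, i < j → Disjoint (L i) (L j) := by
    intro i j hij
    refine disjoint_left.mpr fun z hzi hzj => (hL i hzi).2 ?_
    refine connectedComponentIn_subset _ _ (hL j hzj).1 (g i) ?_
    rw [hF]
    exact mem_iUnion₂.mpr ⟨i, hij, hg i⟩
  have := mk_le_suslinianNumber L hLn fun i j hij => by
    rcases lt_or_gt_of_ne hij with h | h
    · exact hdisj i j h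
    · exact (hdisj j i h).symm
  rw [hι] at this
  exact (Order.lt_succ (suslinianNumber X)).not_ge this

end Separation

/-! ### Rim-weight and covering dimension -/

section Dimension

variable [CompactSpace X]

lemma exists_isTotallyDisconnected_preimage (hX : suslinianNumber X < Cardinal.continuum.{u})
    (f : C(X, ℝ)) : ∃ t ∈ Ioo (0 : ℝ) 1, IsTotallyDisconnected (f ⁻¹' {t}) := by
  by_contra! h
  have key : ∀ t : Ioo (0 : ℝ) 1, ∃ K ⊆ f ⁻¹' {t.1}, IsNondegenerateContinuum K := by
    intro t
    by_contra! hK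
    exact h t t.2 (isTotallyDisconnected_of_forall_not
      (isClosed_singleton.preimage f.continuous) hK)
  choose K hKt hK using key
  have := lift_mk_le_suslinianNumber K hK fun s t hst =>
    ((disjoint_singleton.mpr fun h => hst (Subtype.ext h)).preimage f).mono (hKt s) (hKt t)
  rw [Cardinal.mk_Ioo_real zero_lt_one] at this
  simp only [Cardinal.lift_continuum, Cardinal.lift_id'] at this
  exact hX.not_ge (by simpa using this)

variable [T2Space X]

/-- The boundary of a sublevel set `{f < t}` of a Urysohn function lies in the level set at `t`, and
`t` can be chosen with that level set totally disconnected. -/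
lemma exists_isOpen_isTotallyDisconnected_frontier
    (hX : suslinianNumber X < Cardinal.continuum.{u}) {x : X} {O : Set X} (hO : IsOpen O)
    (hx : x ∈ O) : ∃ U, IsOpen U ∧ IsTotallyDisconnected (frontier U) ∧ x ∈ U ∧ U ⊆ O := by
  obtain ⟨f, h0, h1, -⟩ := exists_continuous_zero_one_of_isClosed (isClosed_singleton (x := x))
    hO.isClosed_compl (disjoint_singleton_left.mpr fun h => h hx)
  obtain ⟨t, ht, hft⟩ := exists_isTotallyDisconnected_preimage hX f
  refine ⟨{y | f y < t}, isOpen_lt f.continuous continuous_const,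
    fun s hs => hft s (hs.trans (frontier_lt_subset_eq f.continuous continuous_const)), ?_, ?_⟩
  · change f x < t
    rw [h0 rfl]
    exact ht.1
  · intro y hy
    by_contra hyO
    have hyt : f y < t := hy
    rw [h1 hyO] at hyt
    exact (hyt.trans ht.2).false

lemma rimWeight_le_suslinianNumber [ConnectedSpace X] [Nontrivial X]
    (hX : suslinianNumber X < Cardinal.continuum.{u}) : rimWeight X ≤ suslinianNumber X := by
  refine le_trans (csInf_le' ⟨{U | IsOpen U ∧ IsTotallyDisconnected (frontier U)}, ?_, rfl⟩)
    (ciSup_le' fun U => weight_le_suslinianNumber_of_isTotallyDisconnected isClosed_frontier U.2.2)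
  refine isTopologicalBasis_of_isOpen_of_nhds (fun U hU => hU.1) fun x O hx hO => ?_
  obtain ⟨U, hU, hUt, hxU, hUO⟩ := exists_isOpen_isTotallyDisconnected_frontier hX hO hx
  exact ⟨U, ⟨hU, hUt⟩, hxU, hUO⟩

lemma isTotallyDisconnected_iUnion_fin {n : ℕ} {Z : Fin n → Set X} (hZ : ∀ i, IsClosed (Z i))
    (h : ∀ i, IsTotallyDisconnected (Z i)) : IsTotallyDisconnected (⋃ i, Z i) := by
  have key : ∀ s : Finset (Fin n), IsTotallyDisconnected (⋃ i ∈ s, Z i) := by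
    intro s
    induction s using Finset.induction_on with
    | empty => simpa using isTotallyDisconnected_empty
    | insert i s _ ih =>
      rw [Finset.set_biUnion_insert]
      exact (h i).union ih (hZ i) (s.finite_toSet.isClosed_biUnion fun j _ => hZ j)
  simpa using key Finset.univ

/-- A cover of a closed totally disconnected set by open sets is refined by a finite disjoint
family of open sets. -/
lemma exists_disjoint_open_refinement {Z : Set X} (hZ : IsClosed Z) (hZt : IsTotallyDisconnected Z)
    {𝒰 : Set (Set X)} (h𝒰 : ∀ U ∈ 𝒰, IsOpen U) (hcov : Z ⊆ ⋃₀ 𝒰) :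
    ∃ (n : ℕ) (O : Fin n → Set X), (∀ i, IsOpen (O i)) ∧ (∀ i, ∃ U ∈ 𝒰, O i ⊆ U) ∧
      Pairwise (Function.onFun Disjoint O) ∧ Z ⊆ ⋃ i, O i := by
  have : CompactSpace Z := isCompact_iff_compactSpace.mp hZ.isCompact
  have : TotallyDisconnectedSpace Z := totallyDisconnectedSpace_subtype_iff.mpr hZt
  have hopen : IsOpenCover (fun U : 𝒰 =>
      (⟨(↑) ⁻¹' U.1, (h𝒰 U.1 U.2).preimage continuous_subtype_val⟩ : Opens Z)) := by
    refine IsOpenCover.of_sets _ (eq_univ_of_forall fun z => ?_)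
    obtain ⟨U, hU, hzU⟩ := hcov z.2
    exact mem_iUnion.mpr ⟨⟨U, hU⟩, hzU⟩
  obtain ⟨n, W, hWU, hWcov, hWd⟩ := hopen.exists_finite_nonempty_disjoint_clopen_cover
  choose k hk using fun z : Z => mem_iUnion.mp (hWcov (mem_univ z))
  have hkW : ∀ z i, z ∈ W i → k z = i := by
    intro z i hz
    by_contra hne
    have hd : Disjoint (W (k z) : Set Z) (W i) := Clopens.coe_disjoint.mpr (hWd hne)
    exact disjoint_left.mp hd (hk z) hz
  have hkc : Continuous k := by
    rw [continuous_discrete_rng]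
    intro i
    have : k ⁻¹' {i} = W i := by
      ext z
      exact ⟨fun h => h ▸ hk z, hkW z i⟩
    rw [this]
    exact (W i).isClopen.isOpen
  -- Tietze extends the piece index `k` to a real function on `X`. Intervals of radius 1/2 about
  -- distinct integers are disjoint, and so are their preimages.
  obtain ⟨g, hg⟩ := ContinuousMap.exists_restrict_eq hZ
    (⟨fun z => ((k z : ℕ) : ℝ), (continuous_of_discreteTopology (f := fun i : Fin n => ((i : ℕ) : ℝ))).comp hkc⟩ : C(Z, ℝ))
  choose U hU using fun i => (hWU i).2
  refine ⟨n, fun i => g ⁻¹' Ioo ((i : ℕ) - 1 / 2 : ℝ) ((i : ℕ) + 1 / 2) ∩ (U i).1,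
    fun i => (isOpen_Ioo.preimage g.continuous).inter (h𝒰 _ (U i).2),
    fun i => ⟨_, (U i).2, inter_subset_right⟩, fun i j hij => disjoint_left.mpr ?_, ?_⟩
  · rintro z ⟨⟨h1, h2⟩, -⟩ ⟨⟨h3, h4⟩, -⟩
    apply hij
    have h5 : ((i : ℕ) : ℝ) < ((j : ℕ) + 1 : ℕ) := by push_cast; linarith
    have h6 : ((j : ℕ) : ℝ) < ((i : ℕ) + 1 : ℕ) := by push_cast; linarith
    rw [Nat.cast_lt] at h5 h6
    exact Fin.ext (by omega)
  · intro z hz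
    have hgz : g z = ((k ⟨z, hz⟩ : ℕ) : ℝ) := DFunLike.congr_fun hg (⟨z, hz⟩ : Z)
    refine mem_iUnion.mpr ⟨k ⟨z, hz⟩, ⟨?_, ?_⟩, hU _ (hk ⟨z, hz⟩)⟩
    · rw [hgz]; linarith
    · rw [hgz]; linarith

/-- Two disjoint open families suffice, one covering the boundaries of a suitable finite cover and
one covering the rest. A point lies in at most one member of each. -/
lemma hasCoveringDimLE_one (hX : suslinianNumber X < Cardinal.continuum.{u}) :
    HasCoveringDimLE X 1 := by
  intro 𝒰 _ h𝒰o h𝒰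
  have key : ∀ x : X, ∃ V, IsOpen V ∧ IsTotallyDisconnected (frontier V) ∧ x ∈ V ∧
      ∃ U ∈ 𝒰, V ⊆ U := by
    intro x
    obtain ⟨U, hU, hxU⟩ : x ∈ ⋃₀ 𝒰 := h𝒰 ▸ mem_univ x
    obtain ⟨V, hV, hVt, hxV, hVU⟩ :=
      exists_isOpen_isTotallyDisconnected_frontier hX (h𝒰o U hU) hxU
    exact ⟨V, hV, hVt, hxV, U, hU, hVU⟩
  choose V' hV'o hV't hxV' hV'U using key
  obtain ⟨t, ht⟩ := isCompact_univ.elim_finite_subcover V' hV'o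
    fun x _ => mem_iUnion.mpr ⟨x, hxV' x⟩
  let V : Fin t.card → Set X := fun i => V' (t.equivFin.symm i)
  have hVcov : ∀ x, ∃ i, x ∈ V i := by
    intro x
    obtain ⟨y, hy, hxy⟩ := mem_iUnion₂.mp (ht (mem_univ x))
    exact ⟨t.equivFin ⟨y, hy⟩, by simpa [V] using hxy⟩
  let W : Fin t.card → Set X := fun i => V i \ ⋃ j ∈ Iio i, closure (V j)
  have hWd : Pairwise (Function.onFun Disjoint W) := by
    have : ∀ i j, i < j → Disjoint (W i) (W j) := fun i j hij => disjoint_left.mpr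
      fun z hzi hzj => hzj.2 (mem_iUnion₂.mpr ⟨i, hij, subset_closure hzi.1⟩)
    intro i j hij
    rcases lt_or_gt_of_ne hij with h | h
    · exact this i j h
    · exact (this j i h).symm
  have hWo : ∀ i, IsOpen (W i) := fun i =>
    (hV'o _).sdiff ((toFinite (Iio i)).isClosed_biUnion fun _ _ => isClosed_closure)
  obtain ⟨n, O, hOo, hOU, hOd, hOcov⟩ := exists_disjoint_open_refinement
    (isClosed_iUnion_of_finite fun i => isClosed_frontier (s := V i))
    (isTotallyDisconnected_iUnion_fin (fun i => isClosed_frontier (s := V i)) fun i => hV't _)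
    h𝒰o (h𝒰 ▸ subset_univ _)
  have hone : ∀ {m : ℕ} (S : Fin m → Set X), Pairwise (Function.onFun Disjoint S) → ∀ x,
      {A ∈ range S | x ∈ A}.encard ≤ 1 := by
    intro m S hS x
    rw [encard_le_one_iff]
    rintro _ _ ⟨⟨i, rfl⟩, hi⟩ ⟨⟨j, rfl⟩, hj⟩
    by_contra hne
    exact disjoint_left.mp (hS fun h => hne (congrArg S h)) hi hj
  refine ⟨range W ∪ range O, (finite_range _).union (finite_range _), ?_, ?_, ?_, fun x => ?_⟩
  · rintro _ (⟨i, rfl⟩ | ⟨i, rfl⟩)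
    · exact hWo i
    · exact hOo i
  · refine eq_univ_of_forall fun x => ?_
    by_cases hx : x ∈ ⋃ i, frontier (V i)
    · obtain ⟨i, hi⟩ := mem_iUnion.mp (hOcov hx)
      exact ⟨O i, Or.inr ⟨i, rfl⟩, hi⟩
    -- For the first `V i` containing `x`, no earlier closure contains `x`, as `x` is on no
    -- boundary.
    · obtain ⟨i, hi, hmin⟩ := wellFounded_lt.has_min {i | x ∈ V i} (hVcov x)
      refine ⟨W i, Or.inl ⟨i, rfl⟩, hi, fun hmem => ?_⟩
      obtain ⟨j, hj, hxj⟩ := mem_iUnion₂.mp hmem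
      refine hx (mem_iUnion.mpr ⟨j, ?_⟩)
      rw [(hV'o _).frontier_eq]
      exact ⟨hxj, fun hxV => hmin j hxV hj⟩
  · rintro _ (⟨i, rfl⟩ | ⟨i, rfl⟩)
    · obtain ⟨U, hU, hVU⟩ := hV'U (t.equivFin.symm i)
      exact ⟨U, hU, sdiff_subset.trans hVU⟩
    · exact hOU i
  · have : {A ∈ range W ∪ range O | x ∈ A} = {A ∈ range W | x ∈ A} ∪ {A ∈ range O | x ∈ A} := by
      ext A
      simp only [mem_union, mem_ofPred_eq, or_and_right]
    rw [this]
    exact (encard_union_le _ _).trans (by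
      simpa using add_le_add (hone W hWd x) (hone O hOd x))

end Dimension

/-! ### The hyperspace of subcontinua -/

section Hyperspace

lemma lindelofNumber_le_mk {B : Set (Set X)} (hB : IsTopologicalBasis B) :
    lindelofNumber X ≤ #B := by
  refine csInf_le' fun 𝒰 h𝒰o h𝒰 => ?_
  let P : Set B := {b | ∃ U ∈ 𝒰, b.1 ⊆ U}
  choose U hU hbU using fun b : P => b.2
  refine ⟨range U, range_subset_iff.mpr hU, eq_univ_of_forall fun x => ?_,
    Cardinal.mk_range_le.trans (Cardinal.mk_set_le _)⟩
  obtain ⟨V, hV, hxV⟩ : x ∈ ⋃₀ 𝒰 := h𝒰 ▸ mem_univ x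
  obtain ⟨b, hb, hxb, hbV⟩ := hB.exists_subset_of_mem_open hxV (h𝒰o V hV)
  exact ⟨_, ⟨⟨⟨b, hb⟩, V, hV, hbV⟩, rfl⟩, hbU ⟨⟨b, hb⟩, V, hV, hbV⟩ hxb⟩

lemma exists_subcover_mk_le_lindelofNumber {𝒰 : Set (Set X)} (h𝒰o : ∀ U ∈ 𝒰, IsOpen U)
    (h𝒰 : ⋃₀ 𝒰 = univ) : ∃ 𝒱 ⊆ 𝒰, ⋃₀ 𝒱 = univ ∧ #𝒱 ≤ lindelofNumber X := by
  refine csInf_mem (s := {κ : Cardinal.{u} | ∀ 𝒰 : Set (Set X), (∀ U ∈ 𝒰, IsOpen U) →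
    ⋃₀ 𝒰 = univ → ∃ 𝒱 ⊆ 𝒰, ⋃₀ 𝒱 = univ ∧ #𝒱 ≤ κ}) ?_ 𝒰 h𝒰o h𝒰
  exact ⟨#(Set X), fun 𝒰 _ h𝒰 => ⟨𝒰, subset_rfl, h𝒰, Cardinal.mk_set_le _⟩⟩

lemma lindelofNumber_le_hereditaryLindelofNumber (Y : Set X) :
    lindelofNumber Y ≤ hereditaryLindelofNumber X :=
  le_ciSup (f := fun Y : Set X => lindelofNumber Y) Cardinal.bddAbove_of_small Y

variable (X) in
lemma mk_le_lindelofNumber_of_discreteTopology [DiscreteTopology X] : #X ≤ lindelofNumber X := by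
  obtain ⟨𝒱, h𝒱, hcov, hcard⟩ := exists_subcover_mk_le_lindelofNumber
    (𝒰 := range fun x : X => ({x} : Set X)) (fun _ _ => isOpen_discrete _)
    (eq_univ_of_forall fun x => ⟨{x}, ⟨x, rfl⟩, rfl⟩)
  refine le_trans (Cardinal.mk_le_of_injective (f := fun x : X => (⟨{x}, ?_⟩ : 𝒱)) ?_) hcard
  · obtain ⟨V, hV, hxV⟩ : x ∈ ⋃₀ 𝒱 := hcov ▸ mem_univ x
    obtain ⟨y, rfl⟩ := h𝒱 hV
    rwa [show x = y from hxV]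
  · intro x y hxy
    simpa using hxy

variable (X) in
lemma aleph0_le_hereditaryLindelofNumber [T2Space X] [Infinite X] :
    ℵ₀ ≤ hereditaryLindelofNumber X := by
  obtain ⟨f, hf⟩ := exists_topology_isEmbedding_nat X
  have : DiscreteTopology (range f) := hf.toHomeomorph.symm.isEmbedding.discreteTopology
  have h := (mk_le_lindelofNumber_of_discreteTopology (range f)).trans
    (lindelofNumber_le_hereditaryLindelofNumber _)
  have : Infinite (range f) := infinite_coe_iff.mpr (infinite_range_of_injective hf.injective)
  exact (Cardinal.aleph0_le_mk _).trans h

/-- A set of cardinality larger than the hereditary Lindelöf number contains a non-empty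
dense-in-itself subset. -/
lemma exists_preperfect_subset [T1Space X] (hX : ℵ₀ ≤ hereditaryLindelofNumber X) {A : Set X}
    (hA : hereditaryLindelofNumber X < #A) :
    ∃ R ⊆ A, R.Nonempty ∧ ∀ x ∈ R, ∀ O, IsOpen O → x ∈ O → ∃ y ∈ R, y ∈ O ∧ y ≠ x := by
  set κ := hereditaryLindelofNumber X
  -- `P` consists of the points of `A` near which `A` has at most `κ` points. A small subcover of
  -- `P` shows `#P ≤ κ`, so `A \ P` is non-empty. An isolated point of `A \ P` would itself belong
  -- to `P`.
  let P : Set X := {x ∈ A | ∃ O, IsOpen O ∧ x ∈ O ∧ #(A ∩ O : Set X) ≤ κ}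
  obtain ⟨𝒱, h𝒱, hcov, hcard⟩ := exists_subcover_mk_le_lindelofNumber (X := P)
    (𝒰 := {V | ∃ O, IsOpen O ∧ #(A ∩ O : Set X) ≤ κ ∧ V = (↑) ⁻¹' O})
    (by rintro _ ⟨O, hO, -, rfl⟩; exact hO.preimage continuous_subtype_val)
    (eq_univ_of_forall fun ⟨x, hxA, O, hO, hxO, hOκ⟩ => ⟨_, ⟨O, hO, hOκ, rfl⟩, hxO⟩)
  choose O hO hOκ hVO using fun V : 𝒱 => h𝒱 V.2
  have hP : #P ≤ κ := by
    refine le_trans (Cardinal.mk_le_mk_of_subset (t := ⋃ V : 𝒱, A ∩ O V) fun x hx => ?_) ?_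
    · obtain ⟨V, hV, hxV⟩ : (⟨x, hx⟩ : P) ∈ ⋃₀ 𝒱 := hcov ▸ mem_univ _
      refine mem_iUnion.mpr ⟨⟨V, hV⟩, hx.1, ?_⟩
      have := hVO ⟨V, hV⟩
      change V = _ at this
      rw [this] at hxV
      exact hxV
    · refine (Cardinal.mk_iUnion_le _).trans ?_
      exact (mul_le_mul' (hcard.trans (lindelofNumber_le_hereditaryLindelofNumber P))
        (ciSup_le' hOκ)).trans (Cardinal.mul_eq_self hX).le
  have hunion : ∀ {S T : Set X}, #S ≤ κ → #T ≤ κ → #(S ∪ T : Set X) ≤ κ := fun hS hT =>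
    (Cardinal.mk_union_le _ _).trans ((add_le_add hS hT).trans (Cardinal.add_eq_self hX).le)
  refine ⟨A \ P, sdiff_subset, ?_, fun x hx U hU hxU => ?_⟩
  · by_contra h
    rw [not_nonempty_iff_eq_empty, sdiff_eq_empty] at h
    exact hA.not_ge ((Cardinal.mk_le_mk_of_subset h).trans hP)
  · by_contra! h
    refine hx.2 ⟨hx.1, U, hU, hxU, ?_⟩
    refine (Cardinal.mk_le_mk_of_subset (t := P ∪ {x}) fun y hy => ?_).trans
      (hunion hP ((Cardinal.mk_singleton x).le.trans (Cardinal.one_le_aleph0.trans hX)))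
    by_cases hyP : y ∈ P
    · exact Or.inl hyP
    · exact Or.inr (h y ⟨hy.1, hyP⟩ hy.2)

instance [T1Space X] [ConnectedSpace X] [Nontrivial X] : Infinite (SubcontinuaHyperspace X) := by
  have : Infinite X := PreconnectedSpace.infinite
  refine Infinite.of_injective
    (fun x : X => (⟨{x}, by simpa using isConnected_singleton⟩ : SubcontinuaHyperspace X)) ?_
  intro x y hxy
  simpa using hxy

lemma hereditaryLindelofNumber_le_weight [T2Space X] [ConnectedSpace X] [Nontrivial X] :
    hereditaryLindelofNumber (SubcontinuaHyperspace X) ≤ weight X := by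
  obtain ⟨B, hB, hBw⟩ := exists_isTopologicalBasis_mk_eq_weight X
  have hfin : hereditaryLindelofNumber (SubcontinuaHyperspace X) ≤ #(Finset B) := by
    refine ciSup_le' fun Y => ?_
    refine (lindelofNumber_le_mk ((hB.nonemptyCompacts.induced Subtype.val).induced
      (Subtype.val : Y → SubcontinuaHyperspace X))).trans ?_
    refine Cardinal.mk_image_le.trans (Cardinal.mk_image_le.trans (Cardinal.mk_image_le.trans ?_))
    refine le_trans (Cardinal.mk_le_mk_of_subset (t := range fun f : Finset B =>
      ((↑) '' (f : Set B) : Set (Set X))) ?_) Cardinal.mk_range_le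
    rintro u ⟨hu, -, huB⟩
    lift u to Set B using huB
    have hu' : u.Finite := hu.of_finite_image Subtype.val_injective.injOn
    exact ⟨hu'.toFinset, by simp⟩
  -- The Vietoris base is indexed by finite subsets of `B`, which costs nothing once `B` is
  -- infinite.
  have hinf : Infinite B := by
    by_contra h
    rw [not_infinite_iff_finite] at h
    exact (Cardinal.mk_lt_aleph0 (α := Finset B)).not_ge
      ((aleph0_le_hereditaryLindelofNumber _).trans hfin)
  rwa [Cardinal.mk_finset_of_infinite, hBw] at hfin

variable [CompactSpace X] [T2Space X]

/-- A disconnection of `K` is witnessed by disjoint open `U`, `V`. Lying in `U ∪ V` and meeting both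
is a Vietoris-open condition that excludes connectedness. -/
lemma isClosed_setOf_isConnected : IsClosed {K : NonemptyCompacts X | IsConnected (K : Set X)} := by
  rw [← isOpen_compl_iff, isOpen_iff_forall_mem_open]
  intro K hK
  have hK' : ¬ IsPreconnected (K : Set X) := fun h => hK ⟨K.nonempty, h⟩
  rw [isPreconnected_iff_subset_of_fully_disjoint_closed K.isCompact.isClosed] at hK'
  push Not at hK'
  obtain ⟨u, v, hu, hv, hKuv, huv, hKu, hKv⟩ := hK'
  obtain ⟨U, V, hU, hV, huU, hvV, hUV⟩ := normal_separation hu hv huv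
  refine ⟨{L | (L : Set X) ⊆ U ∪ V} ∩ {L | ((L : Set X) ∩ U).Nonempty} ∩
    {L | ((L : Set X) ∩ V).Nonempty}, ?_,
    ((NonemptyCompacts.isOpen_subsets_of_isOpen (hU.union hV)).inter
      (NonemptyCompacts.isOpen_inter_nonempty_of_isOpen hU)).inter
      (NonemptyCompacts.isOpen_inter_nonempty_of_isOpen hV),
    ⟨hKuv.trans (union_subset_union huU hvV), ?_⟩, ?_⟩
  · rintro L ⟨⟨hLUV, hLU⟩, ⟨z, hzL, hzV⟩⟩ hL
    exact disjoint_left.mp hUV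
      ((hL : IsConnected (L : Set X)).isPreconnected.subset_left_of_subset_union hU hV hUV hLUV hLU
        hzL) hzV
  · obtain ⟨z, hz, hzv⟩ := not_subset.mp hKv
    exact ⟨z, hz, huU ((hKuv hz).resolve_right hzv)⟩
  · obtain ⟨z, hz, hzu⟩ := not_subset.mp hKu
    exact ⟨z, hz, hvV ((hKuv hz).resolve_left hzu)⟩

instance : CompactSpace (SubcontinuaHyperspace X) :=
  isCompact_iff_compactSpace.mp isClosed_setOf_isConnected.isCompact

/-- A non-empty dense-in-itself disjoint family of non-degenerate subcontinua yields a disjoint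
family of non-degenerate subcontinua of cardinality continuum. -/
lemma continuum_le_suslinianNumber {R : Set (SubcontinuaHyperspace X)} (hR : R.Nonempty)
    (hnt : ∀ K ∈ R, (K.1 : Set X).Nontrivial)
    (hd : ∀ K ∈ R, ∀ L ∈ R, L ≠ K → Disjoint (K.1 : Set X) L.1)
    (hacc : ∀ K ∈ R, ∀ O, IsOpen O → K ∈ O → ∃ L ∈ R, L ∈ O ∧ L ≠ K) :
    Cardinal.continuum.{u} ≤ suslinianNumber X := by
  obtain ⟨K₀, hK₀⟩ := hR
  obtain ⟨a, ha, b, hb, hab⟩ := hnt K₀ hK₀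
  -- All continua in the scheme will meet both `A` and `B`. Limits then meet both disjoint closures
  -- and stay non-degenerate.
  obtain ⟨A, haA, hA, B, hbB, hB, hAB⟩ := exists_open_nhds_disjoint_closure hab
  let Node := {W : Set X // IsClosed W ∧ ∃ K ∈ R, (K.1 : Set X) ⊆ interior W ∧
    ((K.1 : Set X) ∩ A).Nonempty ∧ ((K.1 : Set X) ∩ B).Nonempty}
  -- Near the member `K` of `R` inside `W` there is another member `L`, disjoint from `K`. Disjoint
  -- closed neighbourhoods of the two are the children.
  have hsplit : ∀ W : Node, ∃ c : Bool → Node, (∀ i, (c i).1 ⊆ W.1) ∧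
      Disjoint (c true).1 (c false).1 := by
    rintro ⟨W, -, K, hK, hKW, hKA, hKB⟩
    obtain ⟨L, hL, ⟨⟨hLW, hLA⟩, hLB⟩, hne⟩ := hacc K hK
      (Subtype.val ⁻¹' ({L | (L : Set X) ⊆ interior W} ∩ {L | ((L : Set X) ∩ A).Nonempty} ∩
        {L | ((L : Set X) ∩ B).Nonempty}))
      ((((NonemptyCompacts.isOpen_subsets_of_isOpen isOpen_interior).inter
      (NonemptyCompacts.isOpen_inter_nonempty_of_isOpen hA)).inter
      (NonemptyCompacts.isOpen_inter_nonempty_of_isOpen hB)).preimage continuous_subtype_val)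
      ⟨⟨hKW, hKA⟩, hKB⟩
    obtain ⟨U, V, hU, hV, hKU, hLV, hUV⟩ := normal_separation K.1.isCompact.isClosed
      L.1.isCompact.isClosed (hd K hK L hL hne)
    obtain ⟨U', hU', hKU', hU'U⟩ := normal_exists_closure_subset K.1.isCompact.isClosed
      (hU.inter isOpen_interior) (subset_inter hKU hKW)
    obtain ⟨V', hV', hLV', hV'V⟩ := normal_exists_closure_subset L.1.isCompact.isClosed
      (hV.inter isOpen_interior) (subset_inter hLV hLW)
    refine ⟨fun i => cond i
      ⟨closure U', isClosed_closure, K, hK,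
        hKU'.trans (interior_maximal subset_closure hU'), hKA, hKB⟩
      ⟨closure V', isClosed_closure, L, hL,
        hLV'.trans (interior_maximal subset_closure hV'), hLA, hLB⟩, ?_,
      hUV.mono (hU'U.trans inter_subset_left) (hV'V.trans inter_subset_left)⟩
    rintro (_ | _)
    · exact hV'V.trans (inter_subset_right.trans interior_subset)
    · exact hU'U.trans (inter_subset_right.trans interior_subset)
  choose c hc hcd using hsplit
  let root : Node := ⟨univ, isClosed_univ, K₀, hK₀, by simp, ⟨a, ha, haA⟩, ⟨b, hb, hbB⟩⟩
  let T : (ℕ → Bool) → ℕ → Node := fun β n => Nat.rec root (fun n W => c W (β n)) n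
  -- Compactness of the hyperspace gives a continuum inside every node of the branch.
  have hlim : ∀ β, ∃ K : SubcontinuaHyperspace X, ∀ n, (K.1 : Set X) ⊆ (T β n).1 ∧
      ((K.1 : Set X) ∩ closure A).Nonempty ∧ ((K.1 : Set X) ∩ closure B).Nonempty := by
    intro β
    let F : ℕ → Set (SubcontinuaHyperspace X) := fun n => Subtype.val ⁻¹'
      ({K | (K : Set X) ⊆ (T β n).1} ∩ ({K | ((K : Set X) ∩ closure A).Nonempty} ∩
        {K | ((K : Set X) ∩ closure B).Nonempty}))
    have hF : ∀ n, IsClosed (F n) := fun n =>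
      ((NonemptyCompacts.isClosed_subsets_of_isClosed (T β n).2.1).inter
        ((NonemptyCompacts.isClosed_inter_nonempty_of_isClosed isClosed_closure).inter
        (NonemptyCompacts.isClosed_inter_nonempty_of_isClosed isClosed_closure))).preimage
        continuous_subtype_val
    obtain ⟨K, hK⟩ := IsCompact.nonempty_iInter_of_sequence_nonempty_isCompact_isClosed F
      (fun n K hK => ⟨hK.1.trans (hc (T β n) (β n)), hK.2⟩)
      (fun n => by
        obtain ⟨-, K, -, hKT, hKA, hKB⟩ := (T β n).2
        exact ⟨K, hKT.trans interior_subset, hKA.mono (inter_subset_inter_right _ subset_closure),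
          hKB.mono (inter_subset_inter_right _ subset_closure)⟩)
      (hF 0).isCompact hF
    exact ⟨K, fun n => mem_iInter.mp hK n⟩
  choose K hK using hlim
  have hT : ∀ β γ : ℕ → Bool, ∀ n, (∀ m < n, β m = γ m) → T β n = T γ n := by
    intro β γ n
    induction n with
    | zero => exact fun _ => rfl
    | succ n ih =>
      intro h
      change c (T β n) (β n) = c (T γ n) (γ n)
      rw [ih fun m hm => h m (hm.trans n.lt_succ_self), h n n.lt_succ_self]
  have := lift_mk_le_suslinianNumber (fun β => ((K β).1 : Set X))
    (fun β => ⟨(K β).1.isCompact, (K β).2, by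
      obtain ⟨-, ⟨x, hx, hxA⟩, ⟨y, hy, hyB⟩⟩ := hK β 0
      exact ⟨x, hx, y, hy, fun h => disjoint_left.mp hAB hxA (h ▸ hyB)⟩⟩)
    (by
      intro β γ hne
      -- At the first difference the branches leave a common node for its two disjoint children.
      obtain ⟨n, hn, hmin⟩ := wellFounded_lt.has_min {n | β n ≠ γ n} (Function.ne_iff.mp hne)
      have heq := hT β γ n fun m hm => by
        by_contra h
        exact hmin m h hm
      refine Disjoint.mono ((hK β (n + 1)).1) ((hK γ (n + 1)).1) ?_
      change Disjoint (c (T β n) (β n)).1 (c (T γ n) (γ n)).1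
      rw [heq]
      have hn' : β n ≠ γ n := hn
      cases hβ : β n <;> cases hγ : γ n
      · simp [hβ, hγ] at hn'
      · exact (hcd _).symm
      · exact hcd _
      · simp [hβ, hγ] at hn')
  simpa using this

lemma suslinianNumber_le_hereditaryLindelofNumber [ConnectedSpace X] [Nontrivial X]
    (hX : suslinianNumber X < Cardinal.continuum.{u}) :
    suslinianNumber X ≤ hereditaryLindelofNumber (SubcontinuaHyperspace X) := by
  refine ciSup_le' fun ⟨𝒞, h𝒞, h𝒞d⟩ => ?_
  by_contra! hlt
  let e : 𝒞 → SubcontinuaHyperspace X := fun C =>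
    ⟨⟨⟨C.1, (h𝒞 C C.2).1⟩, (h𝒞 C C.2).2.1.nonempty⟩, (h𝒞 C C.2).2.1⟩
  have hecoe : ∀ C, ((e C).1 : Set X) = C := fun C => rfl
  have he : Function.Injective e := fun C D h => Subtype.ext (by
    rw [← hecoe C, ← hecoe D, h])
  obtain ⟨R, hRA, hR, hacc⟩ := exists_preperfect_subset (A := range e)
    (aleph0_le_hereditaryLindelofNumber _) (by rwa [Cardinal.mk_range_eq _ he])
  refine hX.not_ge (continuum_le_suslinianNumber hR ?_ ?_ hacc)
  · intro K hK
    obtain ⟨C, rfl⟩ := hRA hK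
    exact (h𝒞 C C.2).2.2
  · intro K hK L hL hne
    obtain ⟨C, rfl⟩ := hRA hK
    obtain ⟨D, rfl⟩ := hRA hL
    exact h𝒞d C C.2 D D.2 fun h => hne (congrArg e (Subtype.ext h.symm))

end Hyperspace

/-! ### The one-point continuum -/

section Subsingleton

variable [Subsingleton X]

lemma suslinianNumber_eq_zero_of_subsingleton : suslinianNumber X = 0 := by
  refine le_antisymm (ciSup_le' fun ⟨𝒞, h𝒞, _⟩ => ?_) (zero_le)
  rw [nonpos_iff_eq_zero, Cardinal.mk_eq_zero_iff, isEmpty_coe_sort]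
  exact eq_empty_of_forall_notMem fun C hC =>
    not_nontrivial_iff.mpr (subsingleton_of_subsingleton) (h𝒞 C hC).2.2

lemma rimWeight_eq_zero_of_subsingleton : rimWeight X = 0 := by
  refine le_antisymm (le_trans (csInf_le' ⟨{U : Set X | IsOpen U}, isTopologicalBasis_opens, rfl⟩)
    (ciSup_le' fun U => ?_)) zero_le
  have : IsEmpty (frontier U.1) := by
    rw [isEmpty_coe_sort, ← isClopen_iff_frontier_eq_empty]
    exact isClopen_discrete _
  have hB : IsTopologicalBasis (∅ : Set (Set (frontier U.1))) :=
    isTopologicalBasis_of_isOpen_of_nhds (by simp) fun x => isEmptyElim x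
  simpa using weight_le_mk hB

lemma weight_eq_one_of_subsingleton [Nonempty X] : weight X = 1 := by
  refine le_antisymm ?_ ?_
  · have hB : IsTopologicalBasis ({univ} : Set (Set X)) :=
      isTopologicalBasis_of_isOpen_of_nhds (by simp) fun x U hx _ =>
        ⟨univ, rfl, mem_univ x, fun y _ => Subsingleton.elim x y ▸ hx⟩
    simpa using weight_le_mk hB
  · obtain ⟨B, hB, h⟩ := exists_isTopologicalBasis_mk_eq_weight X
    rw [← h, Cardinal.one_le_iff_ne_zero, Cardinal.mk_ne_zero_iff]
    obtain ⟨x⟩ := ‹Nonempty X›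
    obtain ⟨U, hU, -⟩ := hB.exists_subset_of_mem_open (mem_univ x) isOpen_univ
    exact ⟨⟨U, hU⟩⟩

lemma hereditaryLindelofNumber_le_one_of_subsingleton : hereditaryLindelofNumber X ≤ 1 := by
  refine ciSup_le' fun Y => ?_
  have hB : IsTopologicalBasis ({univ} : Set (Set Y)) :=
    isTopologicalBasis_of_isOpen_of_nhds (by simp) fun x U hx _ =>
      ⟨univ, rfl, mem_univ x, fun y _ => Subsingleton.elim x y ▸ hx⟩
  simpa using lindelofNumber_le_mk hB

end Subsingleton

lemma coveringDim_le_one [CompactSpace X] [T2Space X] [Nonempty X]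
    (hX : suslinianNumber X < Cardinal.continuum.{u}) : coveringDim X ≤ 1 := by
  rw [coveringDim, if_neg (not_isEmpty_of_nonempty X)]
  exact iInf₂_le 1 (hasCoveringDimLE_one hX)

end TopCard

theorem mainTheorem4 (X : Type u) [TopologicalSpace X] [CompactSpace X] [T2Space X]
    [ConnectedSpace X] (hX : TopCard.suslinianNumber X < Cardinal.continuum.{u}) :
    TopCard.coveringDim X ≤ 1 ∧
    TopCard.rimWeight X ≤ TopCard.suslinianNumber X ∧
    TopCard.suslinianNumber X ≤
      TopCard.hereditaryLindelofNumber (TopCard.SubcontinuaHyperspace X) ∧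
    TopCard.hereditaryLindelofNumber (TopCard.SubcontinuaHyperspace X) ≤ TopCard.weight X ∧
    TopCard.weight X ≤ Order.succ (TopCard.suslinianNumber X) := by
  refine ⟨TopCard.coveringDim_le_one hX, ?_⟩
  -- For a point `Sln = 0`, so the arguments using `ℵ₀ ≤ Sln` fail. The chain holds directly, with
  -- weight 1 equal to the successor of 0.
  rcases subsingleton_or_nontrivial X with h | h
  · rw [TopCard.suslinianNumber_eq_zero_of_subsingleton,
      TopCard.rimWeight_eq_zero_of_subsingleton, TopCard.weight_eq_one_of_subsingleton]
    exact ⟨le_rfl, zero_le, TopCard.hereditaryLindelofNumber_le_one_of_subsingleton,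
      by simp⟩
  · exact ⟨TopCard.rimWeight_le_suslinianNumber hX,
      TopCard.suslinianNumber_le_hereditaryLindelofNumber hX,
      TopCard.hereditaryLindelofNumber_le_weight, TopCard.weight_le_succ_suslinianNumber⟩
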